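/- Let $\mathbf{Y}F$ be the Young–Fibonacci lattice: its elements are the finite words in the letters $1$ and $2$ (including the empty word), and its order is the reflexive transitive closure of the relation "$v$ is obtained from $w$ either by deleting the leftmost $1$ of $w$, or by changing into a $1$ some $2$ of $w$ that has only $2$s to its left" (read as $v < w$). It is graded by the sum of the letters. For $r \ge 1$ let $Z(r) = (\mathbf{Y}F)^r$ be its $r$-fold cartesian product with the componentwise order, graded by the sum of the ranks of the components. For $n \ge 0$ let $P_n$ be the (finite) set of elements of rank $n$ of $Z(r)$ and $p_n = |P_n|$. Let $U_n : \mathbb{Z}P_n \to \mathbb{Z}P_{n+1}$ be the linear map sending each element of $P_n$ to the sum of all elements of $P_{n+1}$ that cover it, let $D_{n+1} : \mathbb{Z}P_{n+1} \to \mathbb{Z}P_n$ be the linear map sending each element of $P_{n+1}$ to the sum of all elements of $P_n$ that it covers, put $DU_n = D_{n+1} U_n$, and let $[DU_n]$ be the matrix of $DU_n$ in the standard basis $P_n$ of $\mathbb{Z}P_n$. Then the Miller–Reiner conjecture holds for $Z(r)$: for every $r \ge 1$ and every $n \ge 0$, the matrix $[DU_n] + x I_{p_n}$ has a Smith normal form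 over $\mathbb{Z}[x]$, i.e. there are invertible matrices $A, B \in \mathbb{Z}[x]^{p_n \times p_n}$ such that $A\,([DU_n] + x I_{p_n})\,B$ is a diagonal matrix $\operatorname{diag}(s_1, \dots, s_{p_n})$ with $s_1 \mid s_2 \mid \cdots \mid s_{p_n}$. -/

import Mathlib

open Polynomial

/-! ## Smith normal form -/

/-- The `m × n` matrix `A` has a Smith normal form over `R`: there are invertible matrices `P`, `Q`
such that `B = P A Q` is diagonal with diagonal entries `s₁ ∣ s₂ ∣ ⋯ ∣ s_k`, `k = min m n`. -/
def HasSmithNormalForm {R : Type*} [CommRing R] {m n : ℕ} (A : Matrix (Fin m) (Fin n) R) : Prop :=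
  ∃ (P : Matrix (Fin m) (Fin m) R) (Q : Matrix (Fin n) (Fin n) R), IsUnit P ∧ IsUnit Q ∧
    (∀ (i : Fin m) (j : Fin n), (i : ℕ) ≠ (j : ℕ) → (P * A * Q) i j = 0) ∧
    ∀ (i : ℕ) (hm : i + 1 < m) (hn : i + 1 < n),
      (P * A * Q) ⟨i, Nat.lt_of_succ_lt hm⟩ ⟨i, Nat.lt_of_succ_lt hn⟩ ∣
        (P * A * Q) ⟨i + 1, hm⟩ ⟨i + 1, hn⟩

/-! ## Up and down maps of a graded poset with finite ranks -/

section UpDown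

variable (R : Type*) [CommRing R] (P : Type*) [PartialOrder P] [GradeMinOrder ℕ P]

/-- The `n`-th rank `P_n` of the graded poset `P`. -/
abbrev RankLevel (n : ℕ) : Type _ := {x : P // grade ℕ x = n}

variable [∀ n, Fintype (RankLevel P n)]

open scoped Classical in
/-- The up map `U_n : R P_n → R P_{n+1}`, sending `x ∈ P_n` to the sum of all elements of `P_{n+1}`
that cover `x`. -/
noncomputable def upMap (n : ℕ) : (RankLevel P n →₀ R) →ₗ[R] (RankLevel P (n + 1) →₀ R) :=
  Finsupp.linearCombination R fun x : RankLevel P n =>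
    ∑ y : RankLevel P (n + 1) with x.1 ⋖ y.1, Finsupp.single y (1 : R)

open scoped Classical in
/-- The down map `D_{n+1} : R P_{n+1} → R P_n`, sending `y ∈ P_{n+1}` to the sum of all elements of
`P_n` that are covered by `y`. -/
noncomputable def downMap (n : ℕ) : (RankLevel P (n + 1) →₀ R) →ₗ[R] (RankLevel P n →₀ R) :=
  Finsupp.linearCombination R fun y : RankLevel P (n + 1) =>
    ∑ x : RankLevel P n with x.1 ⋖ y.1, Finsupp.single x (1 : R)

/-- The operator `DU_n = D_{n+1} ∘ U_n` on `R P_n`. -/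
noncomputable def DUMap (n : ℕ) : (RankLevel P n →₀ R) →ₗ[R] (RankLevel P n →₀ R) :=
  downMap R P n ∘ₗ upMap R P n

/-- The matrix `[DU_n]` over `ℤ` with respect to the standard basis `P_n` of `ℤ P_n`, the elements of
`P_n` being listed in the order given by `e`. -/
noncomputable def DUMatrix (n : ℕ) {k : ℕ} (e : RankLevel P n ≃ Fin k) :
    Matrix (Fin k) (Fin k) ℤ :=
  LinearMap.toMatrix (Finsupp.basisSingleOne.reindex e) (Finsupp.basisSingleOne.reindex e)
    (DUMap ℤ P n)

/-- The assertion of the Miller–Reiner conjecture for the poset `P`: for every `n`, the matrix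
`[DU_n] + x I` has a Smith normal form over `ℤ[x]` (whatever the order in which the standard basis
`P_n` is listed). -/
def MillerReinerConjectureFor : Prop :=
  ∀ (n k : ℕ) (e : RankLevel P n ≃ Fin k),
    HasSmithNormalForm ((DUMatrix P n e).map (C : ℤ →+* ℤ[X]) + (X : ℤ[X]) • 1)

end UpDown

/-! ## The Young–Fibonacci lattice -/

/-- The elements of the Young–Fibonacci lattice: finite words in the letters `1` and `2`. The empty
word is `nil`, and `one w`, `two w` are the words `1w`, `2w`. -/
inductive YoungFibonacci : Type
  | nil : YoungFibonacci
  | one : YoungFibonacci → YoungFibonacci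
  | two : YoungFibonacci → YoungFibonacci

namespace YoungFibonacci

/-- The sum of the letters of a word. -/
def letterSum : YoungFibonacci → ℕ
  | nil => 0
  | one w => letterSum w + 1
  | two w => letterSum w + 2

/-- `Step v w` says that `v` is obtained from `w` either by deleting the leftmost `1`, or by changing
into a `1` some `2` that has only `2`s to its left: thus `w = 2⋯2 1 u`, `v = 2⋯2 u`, or
`w = 2⋯2 2 u`, `v = 2⋯2 1 u`, with the same number of leading `2`s in `v` and `w`. -/
inductive Step : YoungFibonacci → YoungFibonacci → Prop
  | delete (u : YoungFibonacci) : Step u (one u)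
  | change (u : YoungFibonacci) : Step (one u) (two u)
  | under_two {v w : YoungFibonacci} : Step v w → Step (two v) (two w)

theorem Step.letterSum_eq {v w : YoungFibonacci} (h : Step v w) :
    w.letterSum = v.letterSum + 1 := by
  induction h with
  | delete u => rfl
  | change u => rfl
  | under_two _ ih => simp only [letterSum, ih]

theorem eq_or_letterSum_lt {v w : YoungFibonacci} (h : Relation.ReflTransGen Step v w) :
    v = w ∨ v.letterSum < w.letterSum := by
  induction h with
  | refl => exact Or.inl rfl
  | tail _ hs ih =>
    have := hs.letterSum_eq
    rcases ih with rfl | ih <;> right <;> omega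

/-- The order of the Young–Fibonacci lattice: the reflexive transitive closure of `Step`. -/
instance : PartialOrder YoungFibonacci where
  le := Relation.ReflTransGen Step
  le_refl _ := Relation.ReflTransGen.refl
  le_trans _ _ _ := Relation.ReflTransGen.trans
  le_antisymm v w h₁ h₂ := by
    rcases eq_or_letterSum_lt h₁ with h | h
    · exact h
    · rcases eq_or_letterSum_lt h₂ with h' | h'
      · exact h'.symm
      · omega

theorem letterSum_strictMono : StrictMono letterSum := fun _ _ h =>
  (eq_or_letterSum_lt h.le).resolve_left h.ne

theorem Step.lt {v w : YoungFibonacci} (h : Step v w) : v < w :=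
  lt_of_le_of_ne (Relation.ReflTransGen.single h) fun e => by
    have := h.letterSum_eq
    rw [e] at this
    omega

/-- The cover relation of the Young–Fibonacci lattice is `Step`. -/
theorem covBy_iff_step {v w : YoungFibonacci} : v ⋖ w ↔ Step v w := by
  constructor
  · intro h
    rcases Relation.ReflTransGen.cases_head h.le with e | ⟨u, hs, hu⟩
    · exact absurd e h.ne
    · rcases eq_or_lt_of_le (show u ≤ w from hu) with rfl | hlt
      · exact hs
      · exact absurd hlt (h.2 hs.lt)
  · intro h
    refine ⟨h.lt, fun u h₁ h₂ => ?_⟩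
    have := letterSum_strictMono h₁
    have := letterSum_strictMono h₂
    have := h.letterSum_eq
    omega

/-- The empty word is the minimum. -/
instance : OrderBot YoungFibonacci where
  bot := nil
  bot_le w := by
    change Relation.ReflTransGen Step nil w
    induction w with
    | nil => exact Relation.ReflTransGen.refl
    | one u ih => exact ih.tail (Step.delete u)
    | two u ih => exact (ih.tail (Step.delete u)).tail (Step.change u)

/-- The Young–Fibonacci lattice is graded by the sum of the letters. -/
instance : GradeMinOrder ℕ YoungFibonacci where
  grade := letterSum
  grade_strictMono := letterSum_strictMono
  covBy_grade _ _ h := by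
    rw [(covBy_iff_step.1 h).letterSum_eq]
    exact Order.covBy_add_one _
  isMin_grade a h := by
    rw [h.eq_bot]
    exact isMin_bot

theorem grade_eq (w : YoungFibonacci) : grade ℕ w = w.letterSum := rfl

theorem finite_letterSum_le (n : ℕ) : {w : YoungFibonacci | w.letterSum ≤ n}.Finite := by
  induction n with
  | zero =>
    refine (Set.finite_singleton nil).subset fun w hw => ?_
    cases w <;> simp_all [letterSum]
  | succ n ih =>
    refine (((Set.finite_singleton nil).union (ih.image one)).union (ih.image two)).subset
      fun w hw => ?_
    rcases w with _ | u | u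
    · simp
    · refine Or.inl (Or.inr ⟨u, ?_, rfl⟩)
      simp only [letterSum, Set.mem_ofPred_eq] at hw ⊢
      omega
    · refine Or.inr ⟨u, ?_, rfl⟩
      simp only [letterSum, Set.mem_ofPred_eq] at hw ⊢
      omega

end YoungFibonacci

/-! ## The posets `Z(r)` -/

/-- `Z(r)`: the `r`-fold cartesian product of the Young–Fibonacci lattice, with the componentwise
order. -/
abbrev YoungFibonacciPower (r : ℕ) : Type := Fin r → YoungFibonacci

namespace YoungFibonacciPower

open YoungFibonacci

/-- `Z(r)` is graded by the sum of the ranks of the components. -/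
instance (r : ℕ) : GradeMinOrder ℕ (YoungFibonacciPower r) where
  grade f := ∑ i, grade ℕ (f i)
  grade_strictMono f g h := by
    obtain ⟨hle, i, hi⟩ := Pi.lt_def.1 h
    exact Finset.sum_lt_sum (fun j _ => grade_mono (hle j)) ⟨i, Finset.mem_univ i, grade_strictMono hi⟩
  covBy_grade f g h := by
    obtain ⟨i, hi, hne⟩ := Pi.covBy_iff.1 h
    have hs : ∑ j, grade ℕ (g j) = ∑ j, grade ℕ (f j) + 1 := by
      rw [← Finset.add_sum_erase _ _ (Finset.mem_univ i),
        ← Finset.add_sum_erase _ (fun j => grade ℕ (f j)) (Finset.mem_univ i)]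
      have h₁ : grade ℕ (g i) = grade ℕ (f i) + 1 := (covBy_iff_step.1 hi).letterSum_eq
      have h₂ : ∑ j ∈ Finset.univ.erase i, grade ℕ (g j) =
          ∑ j ∈ Finset.univ.erase i, grade ℕ (f j) :=
        Finset.sum_congr rfl fun j hj => by rw [hne j (Finset.ne_of_mem_erase hj)]
      rw [h₁, h₂]
      omega
    rw [hs]
    exact Order.covBy_add_one _
  isMin_grade f h := by
    rw [h.eq_bot]
    have : ∑ i : Fin r, grade ℕ ((⊥ : YoungFibonacciPower r) i) = 0 :=
      Finset.sum_eq_zero fun i _ => rfl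
    rw [this]
    exact isMin_bot

theorem grade_eq {r : ℕ} (f : YoungFibonacciPower r) : grade ℕ f = ∑ i, (f i).letterSum := rfl

/-- The ranks of `Z(r)` are finite. -/
noncomputable instance (r n : ℕ) : Fintype (RankLevel (YoungFibonacciPower r) n) :=
  Set.Finite.fintype <| (Set.Finite.pi' fun _ : Fin r => finite_letterSum_le n).subset
    fun f hf i => (Finset.single_le_sum (f := fun j => (f j).letterSum)
      (fun _ _ => Nat.zero_le _) (Finset.mem_univ i)).trans (le_of_eq hf)

end YoungFibonacciPower

/-!
The proof works for every graded poset with finite ranks in which `DU - UD = r`, in which `D` is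
surjective over `ℤ`, and in which the first differences of the rank sizes increase strictly, up to
some small ranks that are treated separately.

Write `M n` for the free module on the elements of rank `n`. The statement amounts to a
decomposition of `M n` as a direct sum of cyclic modules over the polynomial ring in `DU`, with
annihilators that divide each other. Such a decomposition is built by induction on `n`. Since `D` is
the transpose of `U` and is surjective, `U` has a retraction (`exists_leftInverse_upMap`), and so
`M (n + 1)` is the direct sum of `U (M n)` and a free complement `Q`. On `M (n + 1)` the operator
`DU` is `UD + r`, and `UD` acts on `U (M n)` as `DU` does on `M n`. Let `v i`, for `i < l`, be the
generators of the cyclic summands of `M n`. If a basis `v' i` of a complement, `i < m`, satisfies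
`D (v' i) = v i` for `i < l` and `D (v' i) = 0` for `i ≥ l`, then `UD (v' i) = U (v i)` or `0`, so
that the `v' i` generate cyclic summands of `M (n + 1)` whose annihilators are those of the `v i`
multiplied by the variable, or the variable itself. The divisibilities persist. This step is
`SmithPresentation.extend`; working over an arbitrary ring `R` with an arbitrary `t : R` in place of
`ℤ[X]` and `X` takes care of the shift by `r`, and the case `R = ℤ`, `t = 0` shows that the `v i`
generate the cokernel of `DU` on `M n`.

The `v' i` exist because `D` induces a surjection of `Q`, which is free of rank `m`, onto this
cokernel, and because `l < m`: a family of fewer than `m` generators of an abelian group, padded by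
zeros, lifts along any surjection from `ℤ ^ m` to a basis (`exists_span_eq_top_lift`). Correcting
the lifts by elements of the image of `U` makes the equations hold exactly.

For `Z(r)`, the operators in the single coordinates commute, which reduces `DU - UD = r` to the
Young–Fibonacci lattice. There it follows from the reflection property that the words covered by
`2u` are the words that cover `u` (`YoungFibonacci.step_two_right_iff`). The numbers of elements of
rank `n` satisfy a Fibonacci recursion with a contribution of `Z(r - 1)`, from which the inequality
`l < m` follows, except in ranks `≤ 3` for `r = 1` and in rank `1` for `r = 2`. In the exceptional
cases, either the rank has a single element, or one generator has to be lifted to one generator; then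
the cokernel of `DU` is killed by `2` or `3`, so that its generators lift up to sign.
-/

/-! ### Lifting generators along a surjection from a free abelian group -/

theorem span_range_eq_top_of_forall_mem {R M ι κ : Type*} [Semiring R] [AddCommMonoid M]
    [Module R M] {q : ι → M} {q' : κ → M} (hq : Submodule.span R (Set.range q) = ⊤)
    (h : ∀ i, q i ∈ Submodule.span R (Set.range q')) : Submodule.span R (Set.range q') = ⊤ := by
  rw [eq_top_iff, ← hq, Submodule.span_le]
  rintro _ ⟨i, rfl⟩
  exact h i

/-- If two members of a spanning family of an abelian group are mapped to multiples of the same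
element `a`, then a Bézout transformation of these two members makes one of them map to `0`. -/
theorem exists_span_eq_top_map_eq_zero {Q A ι : Type*} [AddCommGroup Q] [AddCommGroup A]
    [DecidableEq ι] (π : Q →ₗ[ℤ] A) (q : ι → Q) (hq : Submodule.span ℤ (Set.range q) = ⊤)
    {i₀ i₁ : ι} (hne : i₀ ≠ i₁) {a : A} {m n : ℤ} (h₀ : π (q i₀) = m • a) (h₁ : π (q i₁) = n • a) :
    ∃ q' : ι → Q, Submodule.span ℤ (Set.range q') = ⊤ ∧ π (q' i₀) = 0 ∧
      (∃ k : ℤ, π (q' i₁) = k • a) ∧ ∀ i, i ≠ i₀ → i ≠ i₁ → q' i = q i := by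
  obtain ⟨x, y, u, w, hdet, hz⟩ : ∃ x y u w : ℤ, x * u + y * w = 1 ∧ m * w = n * u := by
    by_cases hg : Int.gcd m n = 0
    · obtain ⟨rfl, rfl⟩ := Int.gcd_eq_zero_iff.1 hg
      exact ⟨1, 0, 1, 0, by ring, by ring⟩
    · have hg' : (Int.gcd m n : ℤ) ≠ 0 := by exact_mod_cast hg
      obtain ⟨u, hu⟩ := Int.gcd_dvd_left m n
      obtain ⟨w, hw⟩ := Int.gcd_dvd_right m n
      have hb := Int.gcd_eq_gcd_ab m n
      refine ⟨Int.gcdA m n, Int.gcdB m n, u, w, ?_, ?_⟩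
      · apply mul_left_cancel₀ hg'
        linear_combination (-1 : ℤ) * hb - Int.gcdA m n * hu - Int.gcdB m n * hw
      · linear_combination w * hu - u * hw
  let q' : ι → Q := fun i => if i = i₀ then w • q i₀ - u • q i₁ else
    if i = i₁ then x • q i₀ + y • q i₁ else q i
  have e₀ : q' i₀ = w • q i₀ - u • q i₁ := if_pos rfl
  have e₁ : q' i₁ = x • q i₀ + y • q i₁ := by simp [q', hne.symm]
  have e : ∀ i, i ≠ i₀ → i ≠ i₁ → q' i = q i := fun i h h' => by simp [q', h, h']
  have hmem : ∀ i, q' i ∈ Submodule.span ℤ (Set.range q') := fun i =>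
    Submodule.subset_span ⟨i, rfl⟩
  refine ⟨q', span_range_eq_top_of_forall_mem hq fun i => ?_, ?_, ⟨x * m + y * n, ?_⟩, e⟩
  · by_cases hi : i = i₀
    · have : q i = y • q' i₀ + u • q' i₁ := by
        rw [e₀, e₁, hi]
        calc q i₀ = (x * u + y * w) • q i₀ := by rw [hdet, one_smul]
          _ = _ := by module
      rw [this]
      exact add_mem (Submodule.smul_mem _ _ (hmem _)) (Submodule.smul_mem _ _ (hmem _))
    by_cases hi' : i = i₁
    · have : q i = w • q' i₁ - x • q' i₀ := by
        rw [e₀, e₁, hi']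
        calc q i₁ = (x * u + y * w) • q i₁ := by rw [hdet, one_smul]
          _ = _ := by module
      rw [this]
      exact sub_mem (Submodule.smul_mem _ _ (hmem _)) (Submodule.smul_mem _ _ (hmem _))
    · rw [← e i hi hi']
      exact hmem i
  · rw [e₀, map_sub, map_smul, map_smul, h₀, h₁]
    rw [← mul_smul, ← mul_smul, ← sub_smul, show w * m - u * n = 0 by linear_combination hz,
      zero_smul]
  · rw [e₁, map_add, map_smul, map_smul, h₀, h₁]
    module

/-- Let `π : Q → A` be a surjection of abelian groups, where `Q` is generated by `m` elements, and
let `α` be a family of `l < m` generators of `A`. Then `α`, padded by zeros, lifts to a family of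
`m` generators of `Q`. -/
theorem exists_span_eq_top_lift {Q : Type*} [AddCommGroup Q] {m : ℕ} (B : Fin m → Q)
    (hB : Submodule.span ℤ (Set.range B) = ⊤) (l : ℕ) (hl : l < m) :
    ∀ {A : Type*} [AddCommGroup A] (π : Q →ₗ[ℤ] A) (_ : Function.Surjective π) (α : Fin l → A)
      (_ : Submodule.span ℤ (Set.range α) = ⊤),
      ∃ q : Fin m → Q, Submodule.span ℤ (Set.range q) = ⊤ ∧
        ∀ i : Fin m, π (q i) = if h : (i : ℕ) < l then α ⟨i, h⟩ else 0 := by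
  induction l with
  | zero =>
    intro A _ π _ α hα
    refine ⟨B, hB, fun i => ?_⟩
    have : π (B i) ∈ Submodule.span ℤ (Set.range α) := hα ▸ Submodule.mem_top
    simpa using this
  | succ l ih =>
    intro A _ π hπ α hα
    -- Lift the first `l` generators modulo the last one, `a`.
    set a := α (Fin.last l) with ha
    obtain ⟨q₁, hq₁, hα₁⟩ := ih (by omega) ((Submodule.span ℤ {a}).mkQ ∘ₗ π)
      ((Submodule.mkQ_surjective _).comp hπ)
      (fun i => (Submodule.span ℤ {a}).mkQ (α i.castSucc)) (by
        have h := congrArg (Submodule.map (Submodule.span ℤ {a}).mkQ) hα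
        rw [Submodule.map_top, Submodule.range_mkQ, Submodule.map_span, ← Set.range_comp] at h
        refine span_range_eq_top_of_forall_mem h fun i => ?_
        refine Fin.lastCases ?_ (fun j => ?_) i
        · have : (Submodule.span ℤ {a}).mkQ a = 0 := by
            simp
          rw [Function.comp_apply, ← ha, this]
          exact zero_mem _
        · exact Submodule.subset_span ⟨j, rfl⟩)
    let α' : Fin m → A := fun i => if h : (i : ℕ) < l then α ⟨i, by omega⟩ else 0
    have hc₁ : ∀ i, ∃ k : ℤ, π (q₁ i) = α' i + k • a := by
      intro i
      have h : π (q₁ i) - α' i ∈ Submodule.span ℤ {a} := by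
        rw [← Submodule.Quotient.mk_eq_zero, Submodule.Quotient.mk_sub, sub_eq_zero]
        have := hα₁ i
        simp only [LinearMap.comp_apply, Submodule.mkQ_apply] at this
        rw [this]
        by_cases hi : (i : ℕ) < l
        · simp only [α', hi, dite_true]; rfl
        · simp only [α', hi, dite_false]; rfl
      obtain ⟨k, hk⟩ := Submodule.mem_span_singleton.1 h
      exact ⟨k, by rw [hk]; abel⟩
    -- At least two members are mapped to multiples of `a`; make one of them map to `0`.
    let i₀ : Fin m := ⟨l, by omega⟩
    let i₁ : Fin m := ⟨l + 1, hl⟩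
    have hne : i₀ ≠ i₁ := by simp [i₀, i₁]
    have hα₀ : α' i₀ = 0 := by simp [α', i₀]
    have hα₁' : α' i₁ = 0 := by simp [α', i₁]
    obtain ⟨m₀, hm₀⟩ := hc₁ i₀
    obtain ⟨m₁, hm₁⟩ := hc₁ i₁
    rw [hα₀, zero_add] at hm₀
    rw [hα₁', zero_add] at hm₁
    obtain ⟨q₂, hq₂, hz, ⟨k₁, hk₁⟩, he⟩ := exists_span_eq_top_map_eq_zero π q₁ hq₁ hne hm₀ hm₁
    have hc₂ : ∀ i, ∃ k : ℤ, π (q₂ i) = α' i + k • a := by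
      intro i
      by_cases hi : i = i₀
      · exact ⟨0, by rw [hi, hz, hα₀, zero_smul, zero_add]⟩
      by_cases hi' : i = i₁
      · exact ⟨k₁, by rw [hi', hk₁, hα₁', zero_add]⟩
      · rw [he i hi hi']
        exact hc₁ i
    -- Add to that member a preimage of `a` that does not involve it.
    obtain ⟨w, hw⟩ := hπ a
    obtain ⟨x, hx⟩ := (Submodule.mem_span_range_iff_exists_fun ℤ).1
      (show w ∈ Submodule.span ℤ (Set.range q₂) from hq₂ ▸ Submodule.mem_top)
    let w₀ : Q := ∑ i ∈ Finset.univ.erase i₀, x i • q₂ i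
    have hw₀ : π w₀ = a := by
      rw [← Finset.add_sum_erase _ _ (Finset.mem_univ i₀)] at hx
      rw [← hw, ← hx, map_add, map_smul, hz, smul_zero, zero_add]
    choose c hc using hc₂
    let q : Fin m → Q := fun i => if i = i₀ then q₂ i₀ + w₀ else q₂ i - c i • (q₂ i₀ + w₀)
    have e₀ : q i₀ = q₂ i₀ + w₀ := if_pos rfl
    have e : ∀ i, i ≠ i₀ → q i = q₂ i - c i • (q₂ i₀ + w₀) := fun i h => if_neg h
    have hmem : ∀ i, q i ∈ Submodule.span ℤ (Set.range q) := fun i =>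
      Submodule.subset_span ⟨i, rfl⟩
    have hmem' : ∀ i, i ≠ i₀ → q₂ i ∈ Submodule.span ℤ (Set.range q) := fun i hi => by
      rw [show q₂ i = q i + c i • q i₀ by rw [e i hi, e₀]; abel]
      exact add_mem (hmem i) (Submodule.smul_mem _ _ (hmem i₀))
    have hα' : ∀ i : Fin m, i ≠ i₀ →
        α' i = if h : (i : ℕ) < l + 1 then α ⟨i, h⟩ else 0 := by
      intro i hi
      have hi' : (i : ℕ) ≠ l := fun h => hi (Fin.ext h)
      by_cases h : (i : ℕ) < l
      · simp only [α', h, show (i : ℕ) < l + 1 by omega, dite_true]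
      · simp only [α', h, show ¬(i : ℕ) < l + 1 by omega, dite_false]
    refine ⟨q, span_range_eq_top_of_forall_mem hq₂ fun i => ?_, fun i => ?_⟩
    · by_cases hi : i = i₀
      · rw [hi, show q₂ i₀ = q i₀ - w₀ by rw [e₀]; abel]
        exact sub_mem (hmem i₀) (sum_mem fun j hj =>
          Submodule.smul_mem _ _ (hmem' j (Finset.ne_of_mem_erase hj)))
      · exact hmem' i hi
    · by_cases hi : i = i₀
      · rw [hi, e₀, map_add, hz, hw₀, zero_add, dif_pos (show (i₀ : ℕ) < l + 1 by simp [i₀])]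
        rfl
      · rw [e i hi, ← hα' i hi, map_sub, map_smul, map_add, hz, hw₀, hc i]
        rw [zero_add, add_sub_cancel_right]

/-- A version of `exists_span_eq_top_lift` with as many generators in `A` as in `Q`, namely one:
it is true when `A` is killed by `2` or `3`, since every unit modulo `2` or `3` is `1` or `-1`. -/
theorem exists_span_eq_top_lift_one {Q A : Type*} [AddCommGroup Q] [AddCommGroup A] (b : Q)
    (hb : Submodule.span ℤ {b} = ⊤) (π : Q →ₗ[ℤ] A) (hπ : Function.Surjective π) (α : A)
    (hα : Submodule.span ℤ {α} = ⊤) (hA : (∀ a : A, (2 : ℤ) • a = 0) ∨ ∀ a : A, (3 : ℤ) • a = 0) :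
    ∃ q : Q, Submodule.span ℤ {q} = ⊤ ∧ π q = α := by
  obtain ⟨w, hw⟩ := hπ α
  obtain ⟨x, rfl⟩ := Submodule.mem_span_singleton.1
    (show w ∈ Submodule.span ℤ {b} from hb ▸ Submodule.mem_top)
  obtain ⟨y, hy⟩ := Submodule.mem_span_singleton.1
    (show π b ∈ Submodule.span ℤ {α} from hα ▸ Submodule.mem_top)
  rw [map_smul] at hw
  have key : (∃ k : ℤ, x • π b = k • π b ∧ k = 0) ∨ (∃ k : ℤ, x • π b = k • π b ∧ k = 1) ∨
      ∃ k : ℤ, x • π b = k • π b ∧ k = -1 := by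
    have reduce : ∀ d k j : ℤ, (∀ a : A, d • a = 0) → x = d * j + k → x • π b = k • π b := by
      intro d k j hd hx
      rw [hx, add_smul, mul_smul, hd, zero_add]
    rcases hA with hA | hA
    · rcases Int.emod_two_eq_zero_or_one x with h | h
      · exact Or.inl ⟨0, reduce 2 0 (x / 2) hA (by omega), rfl⟩
      · exact Or.inr (Or.inl ⟨1, reduce 2 1 (x / 2) hA (by omega), rfl⟩)
    · have : x % 3 = 0 ∨ x % 3 = 1 ∨ x % 3 = 2 := by omega
      rcases this with h | h | h
      · exact Or.inl ⟨0, reduce 3 0 (x / 3) hA (by omega), rfl⟩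
      · exact Or.inr (Or.inl ⟨1, reduce 3 1 (x / 3) hA (by omega), rfl⟩)
      · exact Or.inr (Or.inr ⟨-1, reduce 3 (-1) (x / 3 + 1) hA (by omega), rfl⟩)
  rcases key with ⟨k, hk, rfl⟩ | ⟨k, hk, rfl⟩ | ⟨k, hk, rfl⟩
  · -- Then `α = 0`, so that `A` is trivial.
    rw [hw, zero_smul] at hk
    exact ⟨b, hb, by rw [← hy, hk, smul_zero]⟩
  · exact ⟨b, hb, by rw [← hw, hk, one_smul]⟩
  · refine ⟨-b, ?_, by rw [← hw, hk, map_neg, neg_one_smul]⟩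
    rw [← Set.neg_singleton, Submodule.span_neg, hb]

/-! ### Presentations by a Smith normal form with prescribed generators -/

/-- `SmithPresentation f v` says that, with respect to suitable bases `b`, `c` of the free module
`N`, the matrix of the endomorphism `f` is `diag(1, …, 1, s₀, …, s_{l-1})` with
`s_{l-1} ∣ ⋯ ∣ s₀`, where moreover the last `l` members of `c` are the given vectors `v i`. So the
cokernel of `f` is the direct sum of the cyclic modules `R/(s i)` generated by the classes of the
`v i`. A basis is encoded as a spanning family with `finrank R N` members. -/
def SmithPresentation {R N : Type*} [CommRing R] [AddCommGroup N] [Module R N] (f : N →ₗ[R] N)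
    {l : ℕ} (v : Fin l → N) : Prop :=
  ∃ (κ : Type) (_ : Fintype κ) (b c : κ ⊕ Fin l → N) (s : Fin l → R),
    Fintype.card κ + l = Module.finrank R N ∧
    Submodule.span R (Set.range b) = ⊤ ∧ Submodule.span R (Set.range c) = ⊤ ∧
    (∀ k, f (b (Sum.inl k)) = c (Sum.inl k)) ∧ (∀ i, c (Sum.inr i) = v i) ∧
    (∀ i, f (b (Sum.inr i)) = s i • v i) ∧ ∀ i j, i ≤ j → s j ∣ s i

theorem SmithPresentation.range_sup_span_eq_top {R N : Type*} [CommRing R] [AddCommGroup N]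
    [Module R N] {f : N →ₗ[R] N} {l : ℕ} {v : Fin l → N} (h : SmithPresentation f v) :
    LinearMap.range f ⊔ Submodule.span R (Set.range v) = ⊤ := by
  obtain ⟨κ, _, b, c, s, -, -, hc, hk, hv, -, -⟩ := h
  rw [eq_top_iff, ← hc, Submodule.span_le]
  rintro _ ⟨k | i, rfl⟩
  · exact Submodule.mem_sup_left ⟨_, hk k⟩
  · exact Submodule.mem_sup_right (hv i ▸ Submodule.subset_span ⟨i, rfl⟩)

/-- Let `M = U N + ⟨v'⟩` be free of rank `finrank N + m`, and let `g` be an endomorphism of `M` that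
extends `f` and satisfies `g (v' i) = U (v i) + t v' i`, with `v` padded by zeros. Then a
presentation of `f` with generators `v` gives a presentation of `g` with generators `v'`: the
invariant factors are multiplied by `t`, and the new ones are equal to `t`. -/
theorem SmithPresentation.extend {R N M : Type*} [CommRing R] [AddCommGroup N] [Module R N]
    [AddCommGroup M] [Module R M] {f : N →ₗ[R] N} {l : ℕ} {v : Fin l → N}
    (h : SmithPresentation f v) {m : ℕ} (hlm : l ≤ m) (g : M →ₗ[R] M) (U : N →ₗ[R] M)
    (v' : Fin m → M) (t : R) (hU : ∀ x, g (U x) = U (f x))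
    (hv' : ∀ i : Fin m, g (v' i) = U (if h : (i : ℕ) < l then v ⟨i, h⟩ else 0) + t • v' i)
    (hspan : LinearMap.range U ⊔ Submodule.span R (Set.range v') = ⊤)
    (hrank : Module.finrank R M = Module.finrank R N + m) : SmithPresentation g v' := by
  obtain ⟨κ, _, b, c, s, hcard, hb, hc, hk, hv, hs, hdvd⟩ := h
  let p : Fin l → Fin m := Fin.castLE hlm
  have hp : ∀ i, g (v' (p i)) = U (v i) + t • v' (p i) := fun i => by
    rw [hv', dif_pos (show (p i : ℕ) < l from i.2)]
    rfl
  let b' : (κ ⊕ Fin l) ⊕ Fin m → M := Sum.elim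
    (Sum.elim (fun k => U (b (Sum.inl k))) fun i => v' (p i))
    fun i => if h : (i : ℕ) < l then s ⟨i, h⟩ • v' i - U (b (Sum.inr ⟨i, h⟩)) else v' i
  let c' : (κ ⊕ Fin l) ⊕ Fin m → M := Sum.elim
    (Sum.elim (fun k => U (c (Sum.inl k))) fun i => U (v i) + t • v' (p i)) v'
  let s' : Fin m → R := fun i => if h : (i : ℕ) < l then t * s ⟨i, h⟩ else t
  have hspan' : ∀ (S : Submodule R M) (d : κ ⊕ Fin l → N), Submodule.span R (Set.range d) = ⊤ →
      (∀ j, U (d j) ∈ S) → (∀ i, v' i ∈ S) → S = ⊤ := by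
    intro S d hd hUd hvd
    rw [eq_top_iff, ← hspan, sup_le_iff, Submodule.span_le, LinearMap.range_eq_map, ← hd,
      Submodule.map_span, Submodule.span_le]
    refine ⟨?_, ?_⟩
    · rintro _ ⟨_, ⟨j, rfl⟩, rfl⟩
      exact hUd j
    · rintro _ ⟨i, rfl⟩
      exact hvd i
  refine ⟨κ ⊕ Fin l, inferInstance, b', c', s', ?_, ?_, ?_, ?_, fun i => rfl, ?_, ?_⟩
  · rw [Fintype.card_sum, Fintype.card_fin, hcard, hrank]
  · have hm : ∀ x, b' x ∈ Submodule.span R (Set.range b') := fun x =>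
      Submodule.subset_span ⟨x, rfl⟩
    have hvm : ∀ i, v' i ∈ Submodule.span R (Set.range b') := fun i => by
      by_cases h : (i : ℕ) < l
      · exact hm (Sum.inl (Sum.inr ⟨i, h⟩))
      · have := hm (Sum.inr i)
        simpa [b', h] using this
    refine hspan' _ b hb ?_ hvm
    rintro (k | i)
    · exact hm (Sum.inl (Sum.inl k))
    · have h2 : b' (Sum.inr (p i)) = s i • v' (p i) - U (b (Sum.inr i)) := by
        simp [b', p]
      rw [show U (b (Sum.inr i)) = s i • v' (p i) - b' (Sum.inr (p i)) by rw [h2]; abel]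
      exact sub_mem (Submodule.smul_mem _ _ (hvm _)) (hm _)
  · have hm : ∀ x, c' x ∈ Submodule.span R (Set.range c') := fun x =>
      Submodule.subset_span ⟨x, rfl⟩
    refine hspan' _ c hc ?_ fun i => hm (Sum.inr i)
    rintro (k | i)
    · exact hm (Sum.inl (Sum.inl k))
    · rw [hv, show U (v i) = c' (Sum.inl (Sum.inr i)) - t • c' (Sum.inr (p i)) by
        simp [c']]
      exact sub_mem (hm _) (Submodule.smul_mem _ _ (hm _))
  · rintro (k | i)
    · simp [b', c', hU, hk]
    · simp [b', c', hp]
  · intro i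
    by_cases h : (i : ℕ) < l
    · have := hp ⟨i, h⟩
      simp only [p, Fin.castLE_mk, Fin.eta] at this
      simp only [b', s', h, dite_true, Sum.elim_inr, map_sub, map_smul, this, hU, hs]
      module
    · simp [b', s', h, hv']
  · intro i j hij
    have hij' : (i : ℕ) ≤ j := hij
    by_cases hj : (j : ℕ) < l
    · simp only [s', hj, hij'.trans_lt hj, dite_true]
      exact mul_dvd_mul_left t (hdvd _ _ hij)
    · by_cases hi : (i : ℕ) < l
      · simp [s', hi, hj]
      · simp [s', hi, hj]

/-- The matrix of an endomorphism with a Smith presentation has a Smith normal form. -/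
theorem SmithPresentation.hasSmithNormalForm {R N : Type*} [CommRing R] [AddCommGroup N]
    [Module R N] {f : N →ₗ[R] N} {l : ℕ} {v : Fin l → N} (h : SmithPresentation f v) {n : ℕ}
    (E : Module.Basis (Fin n) R N) (hn : Module.finrank R N = n) :
    HasSmithNormalForm (LinearMap.toMatrix E E f) := by
  obtain ⟨κ, _, b, c, s, hcard, hb, hc, hk, hv, hs, hdvd⟩ := h
  have hcard' : Fintype.card (κ ⊕ Fin l) = Module.finrank R N := by simpa using hcard
  -- The entries equal to `1` come first, and the remaining ones are listed in reverse order.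
  let σ : Fin n ≃ κ ⊕ Fin l := (finCongr (hn.symm.trans hcard.symm)).trans
    (finSumFinEquiv.symm.trans (Equiv.sumCongr (Fintype.equivFin κ).symm Fin.revPerm))
  let b' := (basisOfTopLeSpanOfCardEqFinrank b hb.ge hcard').reindex σ.symm
  let c' := (basisOfTopLeSpanOfCardEqFinrank c hc.ge hcard').reindex σ.symm
  let d : κ ⊕ Fin l → R := Sum.elim (fun _ => 1) s
  have hb' : ∀ i, b' i = b (σ i) := fun i => by simp [b']
  have hc' : ∀ i, c' i = c (σ i) := fun i => by simp [c']
  have hd : ∀ i, f (b i) = d i • c i := by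
    rintro (k | i)
    · simp [d, hk]
    · simp [d, hs, hv]
  have hmono : ∀ i j : Fin n, i ≤ j → d (σ i) ∣ d (σ j) := by
    intro i j hij
    obtain ⟨i, rfl⟩ := (finCongr (hn.symm.trans hcard.symm)).symm.surjective i
    obtain ⟨j, rfl⟩ := (finCongr (hn.symm.trans hcard.symm)).symm.surjective j
    obtain ⟨i, rfl⟩ := finSumFinEquiv.surjective i
    obtain ⟨j, rfl⟩ := finSumFinEquiv.surjective j
    rcases i with i | i
    · simp [σ, d]
    · rcases j with j | j
      · exfalso
        have h1 : Fintype.card κ + (i : ℕ) ≤ (j : ℕ) := by simpa [Fin.le_def] using hij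
        have := j.2
        omega
      · have h1 : (i : ℕ) ≤ (j : ℕ) := by simpa using hij
        simp only [σ, d, Equiv.trans_apply, Equiv.apply_symm_apply, Equiv.symm_apply_apply,
          Equiv.sumCongr_apply, Sum.map_inr, Sum.elim_inr]
        exact hdvd _ _ (Fin.rev_le_rev.2 h1)
  have hdiag : c'.toMatrix E * LinearMap.toMatrix E E f * E.toMatrix b' =
      Matrix.diagonal fun i => d (σ i) := by
    rw [basis_toMatrix_mul_linearMap_toMatrix_mul_basis_toMatrix]
    ext i j
    rw [LinearMap.toMatrix_apply, hb', hd, ← hc', map_smul, Module.Basis.repr_self,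
      Matrix.diagonal_apply, Finsupp.smul_apply, Finsupp.single_apply]
    by_cases hij : i = j
    · simp [hij]
    · simp [hij, Ne.symm hij]
  refine ⟨c'.toMatrix E, E.toMatrix b', ?_, ?_, ?_, ?_⟩
  · exact IsUnit.of_mul_eq_one _ (c'.toMatrix_mul_toMatrix_flip E)
  · exact IsUnit.of_mul_eq_one _ (E.toMatrix_mul_toMatrix_flip b')
  · intro i j hij
    rw [hdiag, Matrix.diagonal_apply_ne _ fun h => hij (congrArg Fin.val h)]
  · intro i h₁ h₂
    rw [hdiag, Matrix.diagonal_apply_eq, Matrix.diagonal_apply_eq]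
    exact hmono _ _ (by simp [Fin.le_def])

/-! ### Change of the coefficient ring -/

/-- The map `ℤ α → R α` that casts the coefficients of a finitely supported function. -/
noncomputable def castMap (R : Type*) [CommRing R] (α : Type*) : (α →₀ ℤ) →ₗ[ℤ] (α →₀ R) :=
  Finsupp.mapRange.linearMap (Algebra.linearMap ℤ R)

theorem castMap_single (R : Type*) [CommRing R] {α : Type*} (a : α) (k : ℤ) :
    castMap R α (Finsupp.single a k) = Finsupp.single a (k : R) := by
  simp [castMap]

section UpDown

variable (P : Type*) [PartialOrder P] [GradeMinOrder ℕ P] [∀ n, Fintype (RankLevel P n)]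

open scoped Classical in
theorem upMap_single (R : Type*) [CommRing R] (n : ℕ) (x : RankLevel P n) :
    upMap R P n (Finsupp.single x 1) =
      ∑ y : RankLevel P (n + 1) with x.1 ⋖ y.1, Finsupp.single y (1 : R) := by
  rw [upMap, Finsupp.linearCombination_single, one_smul]

open scoped Classical in
theorem downMap_single (R : Type*) [CommRing R] (n : ℕ) (y : RankLevel P (n + 1)) :
    downMap R P n (Finsupp.single y 1) =
      ∑ x : RankLevel P n with x.1 ⋖ y.1, Finsupp.single x (1 : R) := by
  rw [downMap, Finsupp.linearCombination_single, one_smul]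

theorem castMap_upMap (R : Type*) [CommRing R] (n : ℕ) (x : RankLevel P n →₀ ℤ) :
    castMap R _ (upMap ℤ P n x) = upMap R P n (castMap R _ x) := by
  induction x using Finsupp.induction_linear with
  | zero => simp
  | add x y hx hy => simp only [map_add, hx, hy]
  | single a k =>
    rw [← mul_one k, ← smul_eq_mul, ← Finsupp.smul_single, map_smul, map_smul, map_smul,
      map_zsmul, upMap_single, castMap_single, Int.cast_one, upMap_single, map_sum]
    simp only [castMap_single, Int.cast_one]

theorem castMap_downMap (R : Type*) [CommRing R] (n : ℕ) (x : RankLevel P (n + 1) →₀ ℤ) :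
    castMap R _ (downMap ℤ P n x) = downMap R P n (castMap R _ x) := by
  induction x using Finsupp.induction_linear with
  | zero => simp
  | add x y hx hy => simp only [map_add, hx, hy]
  | single a k =>
    rw [← mul_one k, ← smul_eq_mul, ← Finsupp.smul_single, map_smul, map_smul, map_smul,
      map_zsmul, downMap_single, castMap_single, Int.cast_one, downMap_single, map_sum]
    simp only [castMap_single, Int.cast_one]

theorem castMap_DUMap (R : Type*) [CommRing R] (n : ℕ) (x : RankLevel P n →₀ ℤ) :
    castMap R _ (DUMap ℤ P n x) = DUMap R P n (castMap R _ x) := by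
  simp only [DUMap, LinearMap.comp_apply, castMap_downMap, castMap_upMap]

/-- A complement of the image of `U` that is spanned by integral vectors over `ℤ` is spanned by them
over every ring. -/
theorem range_upMap_sup_span_castMap_eq_top {n : ℕ} {ι : Type*}
    {v : ι → RankLevel P (n + 1) →₀ ℤ}
    (h : LinearMap.range (upMap ℤ P n) ⊔ Submodule.span ℤ (Set.range v) = ⊤) (R : Type*)
    [CommRing R] :
    LinearMap.range (upMap R P n) ⊔
      Submodule.span R (Set.range fun i => castMap R _ (v i)) = ⊤ := by
  set S := LinearMap.range (upMap R P n) ⊔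
    Submodule.span R (Set.range fun i => castMap R _ (v i)) with hS
  have key : ∀ x, castMap R _ x ∈ S := by
    have : (⊤ : Submodule ℤ _) ≤ (S.restrictScalars ℤ).comap (castMap R _) := by
      rw [← h, sup_le_iff, Submodule.span_le]
      constructor
      · rintro _ ⟨x, rfl⟩
        rw [Submodule.mem_comap, Submodule.restrictScalars_mem, castMap_upMap]
        exact Submodule.mem_sup_left ⟨_, rfl⟩
      · rintro _ ⟨i, rfl⟩
        exact Submodule.mem_sup_right (Submodule.subset_span ⟨i, rfl⟩)
    exact fun x => this (Submodule.mem_top (x := x))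
  rw [eq_top_iff]
  intro x _
  induction x using Finsupp.induction_linear with
  | zero => exact zero_mem _
  | add x y hx hy => exact add_mem (hx trivial) (hy trivial)
  | single a k =>
    have := S.smul_mem k (key (Finsupp.single a 1))
    rwa [castMap_single, Int.cast_one, Finsupp.smul_single, smul_eq_mul, mul_one] at this

/-! ### Up and down maps with `DU - UD = r` -/

/-- The relation `DU - UD = r` of an `r`-differential poset, over every coefficient ring. -/
structure UpDownCommutation (r : ℕ) : Prop where
  zero : ∀ (R : Type) [CommRing R] (x : RankLevel P 0 →₀ R), DUMap R P 0 x = (r : R) • x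
  succ : ∀ (n : ℕ) (R : Type) [CommRing R] (x : RankLevel P (n + 1) →₀ R),
    DUMap R P (n + 1) x = upMap R P n (downMap R P n x) + (r : R) • x

open scoped Classical in
theorem downMap_apply (R : Type*) [CommRing R] (n : ℕ) (z : RankLevel P (n + 1) →₀ R)
    (x : RankLevel P n) :
    downMap R P n z x = ∑ y : RankLevel P (n + 1) with x.1 ⋖ y.1, z y := by
  induction z using Finsupp.induction_linear with
  | zero => simp
  | add z w hz hw => simp only [map_add, Finsupp.add_apply, hz, hw, Finset.sum_add_distrib]
  | single y k =>
    rw [← mul_one k, ← smul_eq_mul, ← Finsupp.smul_single, map_smul, downMap_single,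
      Finsupp.smul_apply, Finsupp.finsetSum_apply]
    simp only [Finsupp.smul_apply, Finsupp.single_apply, Finset.sum_ite_eq',
      Finset.sum_ite_eq, smul_ite, smul_zero]
    simp

/-- The down map is the transpose of the up map, so a section of the former gives a retraction of
the latter. -/
theorem exists_leftInverse_upMap {n : ℕ} (hD : Function.Surjective (downMap ℤ P n)) :
    ∃ ρ : (RankLevel P (n + 1) →₀ ℤ) →ₗ[ℤ] (RankLevel P n →₀ ℤ), ∀ x, ρ (upMap ℤ P n x) = x := by
  classical
  obtain ⟨σ, hσ⟩ := LinearMap.exists_rightInverse_of_surjective _ (LinearMap.range_eq_top.2 hD)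
  let ρ : (RankLevel P (n + 1) →₀ ℤ) →ₗ[ℤ] (RankLevel P n →₀ ℤ) :=
    Finsupp.linearCombination ℤ fun y =>
      Finsupp.equivFunOnFinite.symm fun x => σ (Finsupp.single x 1) y
  suffices h : ρ ∘ₗ upMap ℤ P n = LinearMap.id from ⟨ρ, LinearMap.congr_fun h⟩
  refine Finsupp.lhom_ext' fun p => LinearMap.ext_ring (Finsupp.ext fun x => ?_)
  simp only [LinearMap.comp_apply, Finsupp.lsingle_apply, LinearMap.id_apply]
  have h := DFunLike.congr_fun (LinearMap.congr_fun hσ (Finsupp.single x 1)) p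
  rw [LinearMap.comp_apply, downMap_apply, LinearMap.id_apply] at h
  rw [upMap_single, map_sum, Finsupp.finsetSum_apply]
  simp only [ρ, Finsupp.linearCombination_single, one_smul, Finsupp.coe_equivFunOnFinite_symm]
  rw [h, Finsupp.single_apply, Finsupp.single_apply]
  simp only [eq_comm]

/-- There are `l` integral vectors in rank `n` which, over every ring `R` and for every `t : R`,
generate the summands of a Smith presentation of `DU + t`. -/
def HasSmithGenerators (n l : ℕ) : Prop :=
  ∃ v : Fin l → RankLevel P n →₀ ℤ, ∀ (R : Type) [CommRing R] [Nontrivial R] (t : R),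
    SmithPresentation (DUMap R P n + t • LinearMap.id) fun i => castMap R _ (v i)

/-- In a rank with a single element, this element is a generator. -/
theorem HasSmithGenerators.of_card_eq_one {n : ℕ} (h : Fintype.card (RankLevel P n) = 1) :
    HasSmithGenerators P n 1 := by
  obtain ⟨a, ha⟩ := Fintype.card_eq_one_iff.1 h
  refine ⟨fun _ => Finsupp.single a 1, fun R _ _ t => ?_⟩
  have hx : ∀ x : RankLevel P n →₀ R, x = x a • Finsupp.single a 1 := by
    intro x
    ext b
    rw [ha b]
    simp
  have hspan : Submodule.span R (Set.range fun _ : Empty ⊕ Fin 1 =>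
      (Finsupp.single a 1 : RankLevel P n →₀ R)) = ⊤ := by
    rw [eq_top_iff]
    intro x _
    rw [hx x]
    exact Submodule.smul_mem _ _ (Submodule.subset_span ⟨Sum.inr 0, rfl⟩)
  refine ⟨Empty, inferInstance, _, _,
    fun _ => DUMap R P n (Finsupp.single a 1) a + t, ?_, hspan, hspan,
    fun k => k.elim, fun i => ?_, fun i => ?_, fun i j _ => dvd_rfl⟩
  · simp [h]
  · simp only [castMap_single, Int.cast_one]
  · simp only [castMap_single, Int.cast_one]
    rw [add_smul, ← hx]
    rfl

/-- Let `ρ` be a retraction of `U`. A basis of `ker ρ` whose image under `D` agrees with the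
generators in rank `n`, padded by zeros, modulo the image of `DU`, can be corrected by elements of
the image of `U` so that the images agree exactly. -/
theorem HasSmithGenerators.of_lift {r n l m : ℕ} (hcomm : UpDownCommutation P r) (hlm : l ≤ m)
    (hm : Fintype.card (RankLevel P (n + 1)) = Fintype.card (RankLevel P n) + m)
    {ρ : (RankLevel P (n + 1) →₀ ℤ) →ₗ[ℤ] (RankLevel P n →₀ ℤ)}
    (hρ : ∀ x, ρ (upMap ℤ P n x) = x) {v : Fin l → RankLevel P n →₀ ℤ}
    (hv : ∀ (R : Type) [CommRing R] [Nontrivial R] (t : R),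
      SmithPresentation (DUMap R P n + t • LinearMap.id) fun i => castMap R _ (v i))
    (q : Fin m → LinearMap.ker ρ) (hq : Submodule.span ℤ (Set.range q) = ⊤)
    (hπ : ∀ i : Fin m, (LinearMap.range (DUMap ℤ P n)).mkQ (downMap ℤ P n (q i)) =
      if h : (i : ℕ) < l then (LinearMap.range (DUMap ℤ P n)).mkQ (v ⟨i, h⟩) else 0) :
    HasSmithGenerators P (n + 1) m := by
  have hy : ∀ i : Fin m, ∃ y, DUMap ℤ P n y =
      downMap ℤ P n (q i) - if h : (i : ℕ) < l then v ⟨i, h⟩ else 0 := by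
    intro i
    have h := hπ i
    rw [← LinearMap.mem_range, ← Submodule.Quotient.mk_eq_zero, Submodule.Quotient.mk_sub,
      sub_eq_zero]
    rw [Submodule.mkQ_apply] at h
    rw [h]
    split_ifs <;> rfl
  choose y hy using hy
  let v' : Fin m → RankLevel P (n + 1) →₀ ℤ := fun i => q i - upMap ℤ P n (y i)
  have hDv : ∀ i, downMap ℤ P n (v' i) = if h : (i : ℕ) < l then v ⟨i, h⟩ else 0 := by
    intro i
    have h := hy i
    rw [DUMap, LinearMap.comp_apply] at h
    rw [map_sub, h, sub_sub_cancel]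
  have hspan : LinearMap.range (upMap ℤ P n) ⊔ Submodule.span ℤ (Set.range v') = ⊤ := by
    set S := LinearMap.range (upMap ℤ P n) ⊔ Submodule.span ℤ (Set.range v')
    have hU : ∀ x, upMap ℤ P n x ∈ S := fun x => Submodule.mem_sup_left ⟨x, rfl⟩
    have hQ : LinearMap.ker ρ ≤ S := by
      have := congrArg (Submodule.map (LinearMap.ker ρ).subtype) hq
      rw [Submodule.map_top, Submodule.range_subtype, Submodule.map_span] at this
      rw [← this, Submodule.span_le]
      rintro _ ⟨_, ⟨i, rfl⟩, rfl⟩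
      have : (q i : RankLevel P (n + 1) →₀ ℤ) = v' i + upMap ℤ P n (y i) := by simp [v']
      rw [Submodule.subtype_apply, this]
      exact add_mem (Submodule.mem_sup_right (Submodule.subset_span ⟨i, rfl⟩)) (hU _)
    rw [eq_top_iff]
    intro x _
    rw [← add_sub_cancel (upMap ℤ P n (ρ x)) x]
    exact add_mem (hU _) (hQ (by rw [LinearMap.mem_ker, map_sub, hρ, sub_self]))
  refine ⟨v', fun R _ _ t => ?_⟩
  -- In rank `n + 1` one has `DU + t = UD + (t + r)`, and `UD` restricts to `DU` on the image of `U`.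
  refine (hv R (t + r)).extend hlm _ (upMap R P n) _ (t + r) (fun x => ?_) (fun i => ?_)
    (range_upMap_sup_span_castMap_eq_top P hspan R) ?_
  · simp only [LinearMap.add_apply, LinearMap.smul_apply, LinearMap.id_apply, hcomm.succ, map_add,
      map_smul]
    simp only [DUMap, LinearMap.comp_apply]
    module
  · have h : downMap R P n (castMap R _ (v' i)) =
        if h : (i : ℕ) < l then castMap R _ (v ⟨i, h⟩) else 0 := by
      rw [← castMap_downMap, hDv]
      split_ifs
      · rfl
      · exact map_zero _
    simp only [LinearMap.add_apply, LinearMap.smul_apply, LinearMap.id_apply, hcomm.succ, h]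
    module
  · rw [Module.finrank_finsupp_self, Module.finrank_finsupp_self, hm]

/-- If `D` is surjective, then every class modulo the image of `DU` is the class of the image under
`D` of an element of the kernel of a given retraction of `U`. -/
theorem surjective_mkQ_downMap_ker {n : ℕ} (hD : Function.Surjective (downMap ℤ P n))
    {ρ : (RankLevel P (n + 1) →₀ ℤ) →ₗ[ℤ] (RankLevel P n →₀ ℤ)}
    (hρ : ∀ x, ρ (upMap ℤ P n x) = x) :
    Function.Surjective ((LinearMap.range (DUMap ℤ P n)).mkQ ∘ₗ downMap ℤ P n ∘ₗ
      (LinearMap.ker ρ).subtype) := by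
  intro a
  obtain ⟨x, rfl⟩ := Submodule.mkQ_surjective _ a
  obtain ⟨z, rfl⟩ := hD x
  refine ⟨⟨z - upMap ℤ P n (ρ z), by rw [LinearMap.mem_ker, map_sub, hρ, sub_self]⟩, ?_⟩
  simp only [LinearMap.comp_apply, Submodule.subtype_apply, map_sub]
  rw [sub_eq_self, Submodule.mkQ_apply, Submodule.Quotient.mk_eq_zero]
  exact ⟨ρ z, rfl⟩

theorem finrank_ker_of_leftInverse_upMap {n m : ℕ}
    (hm : Fintype.card (RankLevel P (n + 1)) = Fintype.card (RankLevel P n) + m)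
    {ρ : (RankLevel P (n + 1) →₀ ℤ) →ₗ[ℤ] (RankLevel P n →₀ ℤ)}
    (hρ : ∀ x, ρ (upMap ℤ P n x) = x) : Module.finrank ℤ (LinearMap.ker ρ) = m := by
  have h := Submodule.finrank_quotient_add_finrank (LinearMap.ker ρ)
  rw [(ρ.quotKerEquivOfSurjective fun x => ⟨_, hρ x⟩).finrank_eq, Module.finrank_finsupp_self,
    Module.finrank_finsupp_self, hm] at h
  omega

/-- The generators span the cokernel of `DU`, by their property for `R = ℤ` and `t = 0`. -/
theorem span_mkQ_eq_top {n l : ℕ} {v : Fin l → RankLevel P n →₀ ℤ}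
    (hv : ∀ (R : Type) [CommRing R] [Nontrivial R] (t : R),
      SmithPresentation (DUMap R P n + t • LinearMap.id) fun i => castMap R _ (v i)) :
    Submodule.span ℤ (Set.range fun i => (LinearMap.range (DUMap ℤ P n)).mkQ (v i)) = ⊤ := by
  have h := (hv ℤ 0).range_sup_span_eq_top
  have hcast : ∀ x : RankLevel P n →₀ ℤ, castMap ℤ _ x = x := fun x => by
    ext
    simp [castMap]
  simp only [hcast, zero_smul, add_zero] at h
  have h' := congrArg (Submodule.map (LinearMap.range (DUMap ℤ P n)).mkQ) h
  rw [Submodule.map_sup, Submodule.mkQ_map_self, bot_sup_eq, Submodule.map_top,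
    Submodule.range_mkQ, Submodule.map_span, ← Set.range_comp] at h'
  exact h'

/-- The main inductive step. With `l` generators in rank `n` and `m > l` new dimensions in rank
`n + 1`, the generators in rank `n`, padded by zeros, lift along `D` to generators in rank `n + 1`. -/
theorem HasSmithGenerators.succ_of_lt {r n l m : ℕ} (hcomm : UpDownCommutation P r)
    (hD : Function.Surjective (downMap ℤ P n)) (hlm : l < m)
    (hm : Fintype.card (RankLevel P (n + 1)) = Fintype.card (RankLevel P n) + m)
    (h : HasSmithGenerators P n l) : HasSmithGenerators P (n + 1) m := by
  obtain ⟨ρ, hρ⟩ := exists_leftInverse_upMap P hD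
  obtain ⟨v, hv⟩ := h
  let B := Module.finBasisOfFinrankEq ℤ _ (finrank_ker_of_leftInverse_upMap P hm hρ)
  obtain ⟨q, hq, hπ⟩ := exists_span_eq_top_lift B B.span_eq l hlm _
    (surjective_mkQ_downMap_ker P hD hρ) _ (span_mkQ_eq_top P hv)
  exact .of_lift P hcomm hlm.le hm hρ hv q hq hπ

/-- The inductive step when the number of generators is `1` both in rank `n` and in rank `n + 1`,
which needs the cokernel of `DU` in rank `n` to be killed by `2` or by `3`. -/
theorem HasSmithGenerators.succ_of_one {r n : ℕ} (hcomm : UpDownCommutation P r)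
    (hD : Function.Surjective (downMap ℤ P n))
    (hm : Fintype.card (RankLevel P (n + 1)) = Fintype.card (RankLevel P n) + 1)
    (hA : (∀ x, (2 : ℤ) • x ∈ LinearMap.range (DUMap ℤ P n)) ∨
      ∀ x, (3 : ℤ) • x ∈ LinearMap.range (DUMap ℤ P n))
    (h : HasSmithGenerators P n 1) : HasSmithGenerators P (n + 1) 1 := by
  obtain ⟨ρ, hρ⟩ := exists_leftInverse_upMap P hD
  obtain ⟨v, hv⟩ := h
  let B := Module.finBasisOfFinrankEq ℤ _ (finrank_ker_of_leftInverse_upMap P hm hρ)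
  have hA' : ∀ d : ℤ, (∀ x, d • x ∈ LinearMap.range (DUMap ℤ P n)) →
      ∀ a : (RankLevel P n →₀ ℤ) ⧸ LinearMap.range (DUMap ℤ P n), d • a = 0 := by
    intro d hd a
    obtain ⟨x, rfl⟩ := Submodule.mkQ_surjective _ a
    rw [← map_smul, Submodule.mkQ_apply, Submodule.Quotient.mk_eq_zero]
    exact hd x
  have hB := B.span_eq
  have hα := span_mkQ_eq_top P hv
  rw [Set.range_unique] at hB hα
  obtain ⟨q, hq, hπ⟩ := exists_span_eq_top_lift_one _ hB _
    (surjective_mkQ_downMap_ker P hD hρ) _ hα (hA.imp (hA' 2) (hA' 3))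
  refine .of_lift P hcomm le_rfl hm hρ hv (fun _ => q) (by rwa [Set.range_const]) fun i => ?_
  rw [dif_pos i.2]
  have : (⟨i, i.2⟩ : Fin 1) = default := Subsingleton.elim _ _
  rw [this]
  exact hπ

theorem HasSmithGenerators.hasSmithNormalForm {n l k : ℕ} (h : HasSmithGenerators P n l)
    (e : RankLevel P n ≃ Fin k) :
    HasSmithNormalForm ((DUMatrix P n e).map (C : ℤ →+* ℤ[X]) + (X : ℤ[X]) • 1) := by
  obtain ⟨v, hv⟩ := h
  have hk : Module.finrank ℤ[X] (RankLevel P n →₀ ℤ[X]) = k := by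
    rw [Module.finrank_finsupp_self, Fintype.card_congr e, Fintype.card_fin]
  have := (hv ℤ[X] X).hasSmithNormalForm (Finsupp.basisSingleOne.reindex e) hk
  convert this using 1
  rw [map_add, map_smul, LinearMap.toMatrix_id]
  congr 1
  ext1 i j
  have h := DFunLike.congr_fun (castMap_DUMap P ℤ[X] n (Finsupp.single (e.symm j) 1)) (e.symm i)
  rw [castMap_single, Int.cast_one] at h
  simp only [DUMatrix, Matrix.map_apply, LinearMap.toMatrix_apply, Module.Basis.coe_reindex,
    Function.comp_apply, Finsupp.coe_basisSingleOne, Module.Basis.repr_reindex_apply,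
    Finsupp.basisSingleOne_repr, LinearEquiv.refl_apply]
  rw [← h]
  simp [castMap]

end UpDown

/-! ### The commutation relation for the powers of the Young–Fibonacci lattice -/

namespace YoungFibonacci

theorem step_two_right_iff {u w : YoungFibonacci} : Step w (two u) ↔ Step u w := by
  induction w generalizing u with
  | nil => exact ⟨fun h => (by cases h), fun h => (by cases h)⟩
  | one a =>
    constructor
    · intro h
      cases h
      exact .delete _
    · intro h
      cases h
      exact .change _
  | two a ih =>
    have h₁ : Step (two a) (two u) ↔ Step a u :=
      ⟨fun h => by cases h; assumption, .under_two⟩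
    rw [h₁]
    cases u with
    | nil => exact ⟨fun h => (by cases h), fun h => (by cases h)⟩
    | one b =>
      constructor
      · intro h
        cases h
        exact .change _
      · intro h
        cases h
        exact .delete _
    | two b =>
      rw [ih]
      exact ⟨.under_two, fun h => by cases h; assumption⟩

theorem step_one_right_iff {u w : YoungFibonacci} : Step w (one u) ↔ w = u := by
  constructor
  · intro h
    cases h
    rfl
  · rintro rfl
    exact .delete _

variable (R : Type*) [CommRing R]

/-- The sum of the words covered by a given word. The words covered by `2u` are those that cover
`u`; these are `1u`, and the words `2v` with `v` covered by `u`. -/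
noncomputable def lowerSum : YoungFibonacci → (YoungFibonacci →₀ R)
  | nil => 0
  | one u => Finsupp.single u 1
  | two u => Finsupp.single (one u) 1 + Finsupp.mapDomain two (lowerSum u)

open scoped Classical in
theorem lowerSum_apply (w v : YoungFibonacci) :
    lowerSum R w v = if Step v w then 1 else 0 := by
  induction w generalizing v with
  | nil => rw [if_neg fun h => by cases h]; rfl
  | one u => simp only [lowerSum, step_one_right_iff, Finsupp.single_apply, eq_comm]
  | two u ih =>
    rw [lowerSum, Finsupp.add_apply, step_two_right_iff]
    rcases v with _ | v | v
    · rw [Finsupp.mapDomain_of_notMem_range _ _ (by simp), Finsupp.single_apply, if_neg (by simp),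
        if_neg (fun h => by cases h)]
      exact add_zero 0
    · rw [Finsupp.mapDomain_of_notMem_range _ _ (by simp), Finsupp.single_apply, step_one_right_iff,
        one.injEq, add_zero]
    · rw [Finsupp.mapDomain_apply (fun a b => two.inj), ih, step_two_right_iff,
        Finsupp.single_apply, if_neg (by simp), zero_add]

/-- The down operator of the Young–Fibonacci lattice, on all ranks at once. -/
noncomputable def lower : (YoungFibonacci →₀ R) →ₗ[R] (YoungFibonacci →₀ R) :=
  Finsupp.linearCombination R (lowerSum R)

/-- The up operator of the Young–Fibonacci lattice, on all ranks at once. -/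
noncomputable def raise : (YoungFibonacci →₀ R) →ₗ[R] (YoungFibonacci →₀ R) :=
  Finsupp.linearCombination R fun w => lowerSum R (two w)

open scoped Classical in
theorem raise_single_apply (w v : YoungFibonacci) :
    raise R (Finsupp.single w 1) v = if Step w v then 1 else 0 := by
  rw [raise, Finsupp.linearCombination_single, one_smul, lowerSum_apply]
  simp only [step_two_right_iff]

open scoped Classical in
theorem lower_single_apply (w v : YoungFibonacci) :
    lower R (Finsupp.single w 1) v = if Step v w then 1 else 0 := by
  rw [lower, Finsupp.linearCombination_single, one_smul, lowerSum_apply]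

/-- Prefixing a `2` and then applying the down operator amounts to applying the up operator. -/
theorem lower_mapDomain_two (x : YoungFibonacci →₀ R) :
    lower R (Finsupp.mapDomain two x) = raise R x := by
  rw [lower, raise, Finsupp.linearCombination_mapDomain]
  rfl

theorem lower_raise (x : YoungFibonacci →₀ R) : lower R (raise R x) = raise R (lower R x) + x := by
  induction x using Finsupp.induction_linear with
  | zero => simp
  | add x y hx hy => simp only [map_add, hx, hy]; abel
  | single w k =>
    rw [← mul_one k, ← smul_eq_mul, ← Finsupp.smul_single]
    simp only [map_smul, ← smul_add]
    congr 1
    have h₁ : raise R (Finsupp.single w 1) =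
        Finsupp.single (one w) 1 + Finsupp.mapDomain two (lower R (Finsupp.single w 1)) := by
      simp [raise, lower, lowerSum]
    have h₂ : lower R (Finsupp.single (one w) 1) = Finsupp.single w 1 := by
      simp [lower, lowerSum]
    rw [h₁, map_add, h₂, lower_mapDomain_two, add_comm]

end YoungFibonacci

section Coordinates

variable {R ι α : Type*} [CommRing R] [DecidableEq ι]

/-- The operator on functions of `f : ι → α` that acts by `T` on the coordinate `i`. -/
noncomputable def onCoordinate (i : ι) (T : (α →₀ R) →ₗ[R] (α →₀ R)) :
    ((ι → α) →₀ R) →ₗ[R] ((ι → α) →₀ R) :=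
  Finsupp.linearCombination R fun f =>
    Finsupp.mapDomain (Function.update f i) (T (Finsupp.single (f i) 1))

theorem onCoordinate_single (i : ι) (T : (α →₀ R) →ₗ[R] (α →₀ R)) (f : ι → α) :
    onCoordinate i T (Finsupp.single f 1) =
      Finsupp.mapDomain (Function.update f i) (T (Finsupp.single (f i) 1)) := by
  rw [onCoordinate, Finsupp.linearCombination_single, one_smul]

theorem onCoordinate_mapDomain_update (i : ι) (T : (α →₀ R) →ₗ[R] (α →₀ R)) (f : ι → α)
    (x : α →₀ R) :
    onCoordinate i T (Finsupp.mapDomain (Function.update f i) x) =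
      Finsupp.mapDomain (Function.update f i) (T x) := by
  induction x using Finsupp.induction_linear with
  | zero => simp
  | add x y hx hy => simp only [map_add, Finsupp.mapDomain_add, hx, hy]
  | single a k =>
    rw [← mul_one k, ← smul_eq_mul, ← Finsupp.smul_single, map_smul, Finsupp.mapDomain_smul,
      Finsupp.mapDomain_smul, map_smul, Finsupp.mapDomain_single, onCoordinate_single]
    rw [Function.update_self, show Function.update (Function.update f i a) i =
      Function.update f i from funext fun b => Function.update_idem ..]

theorem onCoordinate_comm {i j : ι} (hij : i ≠ j) (S T : (α →₀ R) →ₗ[R] (α →₀ R))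
    (x : (ι → α) →₀ R) :
    onCoordinate i S (onCoordinate j T x) = onCoordinate j T (onCoordinate i S x) := by
  induction x using Finsupp.induction_linear with
  | zero => simp
  | add x y hx hy => simp only [map_add, hx, hy]
  | single f k =>
    rw [← mul_one k, ← smul_eq_mul, ← Finsupp.smul_single]
    simp only [map_smul]
    congr 1
    have key : ∀ (i j : ι), i ≠ j → ∀ (S : (α →₀ R) →ₗ[R] (α →₀ R)) (f : ι → α) (y : α →₀ R),
        onCoordinate i S (Finsupp.mapDomain (Function.update f j) y) =
          y.sum fun b k => (S (Finsupp.single (f i) 1)).sum fun a l =>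
            Finsupp.single (Function.update (Function.update f j b) i a) (k * l) := by
      intro i j hij S f y
      rw [Finsupp.mapDomain, map_finsuppSum]
      refine Finsupp.sum_congr fun b _ => ?_
      rw [← mul_one (y b), ← smul_eq_mul (y b), ← Finsupp.smul_single, map_smul,
        onCoordinate_single, Function.update_of_ne hij, Finsupp.mapDomain, Finsupp.smul_sum]
      simp
    rw [onCoordinate_single, onCoordinate_single, key i j hij, key j i hij.symm,
      Finsupp.sum_comm]
    simp only [Function.update_comm hij, mul_comm]

theorem sum_onCoordinate_comm [Fintype ι] (S T : (α →₀ R) →ₗ[R] (α →₀ R))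
    (h : ∀ x, S (T x) = T (S x) + x) (x : (ι → α) →₀ R) :
    (∑ i, onCoordinate i S) ((∑ i, onCoordinate i T) x) =
      (∑ i, onCoordinate i T) ((∑ i, onCoordinate i S) x) + (Fintype.card ι : R) • x := by
  have h' : ∀ i j, onCoordinate i S (onCoordinate j T x) =
      onCoordinate j T (onCoordinate i S x) + if i = j then x else 0 := by
    intro i j
    by_cases hij : i = j
    · subst hij
      rw [if_pos rfl]
      induction x using Finsupp.induction_linear with
      | zero => simp
      | add x y hx hy => simp only [map_add, hx, hy]; abel
      | single f k =>
        rw [← mul_one k, ← smul_eq_mul, ← Finsupp.smul_single]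
        simp only [map_smul, ← smul_add]
        congr 1
        rw [onCoordinate_single, onCoordinate_single, onCoordinate_mapDomain_update,
          onCoordinate_mapDomain_update, h, Finsupp.mapDomain_add, Finsupp.mapDomain_single,
          Function.update_eq_self]
    · rw [if_neg hij, add_zero, onCoordinate_comm hij]
  simp only [LinearMap.sum_apply, map_sum, h', Finset.sum_add_distrib]
  rw [Finset.sum_comm]
  simp [Nat.cast_smul_eq_nsmul]

theorem mapDomain_update_apply (f g : ι → α) (i : ι) (x : α →₀ R) :
    Finsupp.mapDomain (Function.update f i) x g =
      haveI := Classical.dec (∀ j, j ≠ i → g j = f j)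
      if ∀ j, j ≠ i → g j = f j then x (g i) else 0 := by
  split_ifs with h
  · have : g = Function.update f i (g i) := by
      rw [Function.eq_update_iff]
      exact ⟨rfl, h⟩
    conv_lhs => rw [this]
    rw [Finsupp.mapDomain_apply (Function.update_injective f i)]
  · refine Finsupp.mapDomain_of_notMem_range _ _ ?_
    rintro ⟨a, rfl⟩
    exact h fun j hj => Function.update_of_ne hj _ _

open scoped Classical in
/-- If `T a` is the indicator function of a relation `r a` for every `a`, then `∑ i, T i` maps `f`
to the indicator function of the functions that are related to `f` in exactly one coordinate and
equal to it in the others. -/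
theorem sum_onCoordinate_single_apply [Fintype ι] (T : (α →₀ R) →ₗ[R] (α →₀ R))
    (r : α → α → Prop) (hr : ∀ a, ¬r a a)
    (hT : ∀ a b, T (Finsupp.single a 1) b = if r a b then 1 else 0) (f g : ι → α)
    [Decidable (∃ i, r (f i) (g i) ∧ ∀ j, j ≠ i → g j = f j)] :
    (∑ i, onCoordinate i T) (Finsupp.single f 1) g =
      if ∃ i, r (f i) (g i) ∧ ∀ j, j ≠ i → g j = f j then 1 else 0 := by
  rw [LinearMap.sum_apply, Finsupp.finsetSum_apply]
  have h : ∀ i, onCoordinate i T (Finsupp.single f 1) g =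
      if r (f i) (g i) ∧ ∀ j, j ≠ i → g j = f j then 1 else 0 := by
    intro i
    rw [onCoordinate_single, mapDomain_update_apply, hT]
    by_cases h₁ : ∀ j, j ≠ i → g j = f j
    · by_cases h₂ : r (f i) (g i) <;> simp [h₂]
    · simp [h₁]
  simp only [h]
  split_ifs with hex
  · obtain ⟨i, hi⟩ := hex
    rw [Finset.sum_eq_single i, if_pos hi]
    · intro j _ hj
      refine if_neg fun hj' => hr (f i) ?_
      have := hj'.2 i hj.symm
      rw [← this] at hi ⊢
      rw [this] at hi
      simpa [this] using hi.1
    · simp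
  · exact Finset.sum_eq_zero fun i _ => if_neg fun hi => hex ⟨i, hi⟩

end Coordinates

namespace YoungFibonacciPower

open YoungFibonacci

variable (R : Type*) [CommRing R] (r : ℕ)

theorem covBy_iff_exists_step {f g : YoungFibonacciPower r} :
    f ⋖ g ↔ ∃ i, Step (f i) (g i) ∧ ∀ j, j ≠ i → f j = g j := by
  simp only [Pi.covBy_iff, covBy_iff_step]

theorem grade_eq_of_covBy {f g : YoungFibonacciPower r} (h : f ⋖ g) :
    grade ℕ g = grade ℕ f + 1 := by
  have := h.grade ℕ
  rw [Nat.covBy_iff_add_one_eq] at this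
  exact this.symm

/-- The inclusion of the functions on the elements of rank `n` into the functions on `Z(r)`. -/
noncomputable def levelInclusion (n : ℕ) :
    (RankLevel (YoungFibonacciPower r) n →₀ R) →ₗ[R] (YoungFibonacciPower r →₀ R) :=
  Finsupp.lmapDomain R R Subtype.val

theorem levelInclusion_injective (n : ℕ) : Function.Injective (levelInclusion R r n) :=
  Finsupp.mapDomain_injective Subtype.val_injective

open scoped Classical in
theorem levelInclusion_sum_single_apply {n : ℕ}
    (p : YoungFibonacciPower r → Prop) (g : YoungFibonacciPower r) :
    levelInclusion R r n
      (∑ y : RankLevel (YoungFibonacciPower r) n with p y.1, Finsupp.single y 1) g =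
      if grade ℕ g = n ∧ p g then 1 else 0 := by
  simp only [levelInclusion, map_sum, Finsupp.lmapDomain_apply, Finsupp.mapDomain_single,
    Finsupp.finsetSum_apply, Finsupp.single_apply]
  split_ifs with h
  · rw [Finset.sum_eq_single_of_mem ⟨g, h.1⟩ (by simpa using h.2)]
    · rw [if_pos rfl]
    · intro b _ hb
      exact if_neg fun h => hb (Subtype.ext h)
  · refine Finset.sum_eq_zero fun b hb => if_neg ?_
    rintro rfl
    exact h ⟨b.2, (Finset.mem_filter.1 hb).2⟩

theorem levelInclusion_upMap (n : ℕ) (x : RankLevel (YoungFibonacciPower r) n →₀ R) :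
    levelInclusion R r (n + 1) (upMap R _ n x) =
      (∑ i, onCoordinate i (raise R)) (levelInclusion R r n x) := by
  classical
  induction x using Finsupp.induction_linear with
  | zero => simp
  | add x y hx hy => simp only [map_add, hx, hy]
  | single f k =>
    rw [← mul_one k, ← smul_eq_mul, ← Finsupp.smul_single]
    simp only [map_smul]
    congr 1
    have h₁ : levelInclusion R r n (Finsupp.single f 1) = Finsupp.single f.1 1 := by
      simp [levelInclusion]
    ext g
    rw [h₁, upMap_single, levelInclusion_sum_single_apply R r (fun y => f.1 ⋖ y),
      sum_onCoordinate_single_apply _ Step (fun a h => (h.lt).ne rfl) (raise_single_apply R)]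
    refine if_congr ?_ rfl rfl
    rw [and_iff_right_of_imp fun h => by rw [grade_eq_of_covBy r h, f.2], covBy_iff_exists_step]
    simp only [eq_comm]

theorem levelInclusion_downMap (n : ℕ) (x : RankLevel (YoungFibonacciPower r) (n + 1) →₀ R) :
    levelInclusion R r n (downMap R _ n x) =
      (∑ i, onCoordinate i (lower R)) (levelInclusion R r (n + 1) x) := by
  classical
  induction x using Finsupp.induction_linear with
  | zero => simp
  | add x y hx hy => simp only [map_add, hx, hy]
  | single f k =>
    rw [← mul_one k, ← smul_eq_mul, ← Finsupp.smul_single]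
    simp only [map_smul]
    congr 1
    have h₁ : levelInclusion R r (n + 1) (Finsupp.single f 1) = Finsupp.single f.1 1 := by
      simp [levelInclusion]
    ext g
    rw [h₁, downMap_single, levelInclusion_sum_single_apply R r (fun y => y ⋖ f.1),
      sum_onCoordinate_single_apply _ (fun a b => Step b a) (fun a h => (h.lt).ne rfl)
        (lower_single_apply R)]
    refine if_congr ?_ rfl rfl
    rw [and_iff_right_of_imp fun h => by
      have := grade_eq_of_covBy r h
      rw [f.2] at this
      omega, covBy_iff_exists_step]

theorem sum_onCoordinate_lower_levelInclusion_zero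
    (x : RankLevel (YoungFibonacciPower r) 0 →₀ R) :
    (∑ i, onCoordinate i (lower R)) (levelInclusion R r 0 x) = 0 := by
  classical
  induction x using Finsupp.induction_linear with
  | zero => simp
  | add x y hx hy => simp only [map_add, hx, hy, add_zero]
  | single f k =>
    have h₁ : levelInclusion R r 0 (Finsupp.single f k) = k • Finsupp.single f.1 1 := by
      simp [levelInclusion]
    rw [h₁, map_smul]
    have h₂ : (∑ i, onCoordinate i (lower R)) (Finsupp.single f.1 1) = 0 := by
      ext g
      rw [sum_onCoordinate_single_apply _ (fun a b => Step b a) (fun a h => (h.lt).ne rfl)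
        (lower_single_apply R)]
      refine if_neg ?_
      rw [← covBy_iff_exists_step]
      intro h
      have := grade_eq_of_covBy r h
      rw [f.2] at this
      omega
    rw [h₂, smul_zero]

theorem upDownCommutation : UpDownCommutation (YoungFibonacciPower r) r where
  zero R _ x := by
    apply levelInclusion_injective R r 0
    rw [DUMap, LinearMap.comp_apply, levelInclusion_downMap, levelInclusion_upMap,
      sum_onCoordinate_comm _ _ (lower_raise R), sum_onCoordinate_lower_levelInclusion_zero,
      map_zero, zero_add, map_smul, Fintype.card_fin]
  succ n R _ x := by
    apply levelInclusion_injective R r (n + 1)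
    rw [DUMap, LinearMap.comp_apply, levelInclusion_downMap, levelInclusion_upMap,
      sum_onCoordinate_comm _ _ (lower_raise R), map_add, levelInclusion_upMap,
      levelInclusion_downMap, map_smul, Fintype.card_fin]

/-! ### Surjectivity of the down map -/

/-- The word `1 f₀` covers `f₀` only, so `D` maps the tuple obtained from `f` by replacing its first
component by `1 f₀` to `f`, up to tuples whose first component has larger rank. -/
theorem downMap_surjective (n : ℕ) (hr : 1 ≤ r) :
    Function.Surjective (downMap ℤ (YoungFibonacciPower r) n) := by
  classical
  obtain ⟨r, rfl⟩ := Nat.exists_eq_add_of_le' hr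
  rw [← LinearMap.range_eq_top]
  have key : ∀ (k : ℕ) (f : RankLevel (YoungFibonacciPower (r + 1)) n),
      n ≤ (f.1 0).letterSum + k →
        Finsupp.single f (1 : ℤ) ∈ LinearMap.range (downMap ℤ (YoungFibonacciPower (r + 1)) n) := by
    intro k
    induction k using Nat.strong_induction_on with
    | _ k ih =>
      intro f hf
      let g : YoungFibonacciPower (r + 1) := Function.update f.1 0 (one (f.1 0))
      have hg₀ : g 0 = one (f.1 0) := Function.update_self _ _ _
      have hg : ∀ j, j ≠ 0 → g j = f.1 j := fun j hj => Function.update_of_ne hj _ _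
      have hfg : f.1 ⋖ g := (covBy_iff_exists_step _).2
        ⟨0, by rw [hg₀]; exact .delete _, fun j hj => (hg j hj).symm⟩
      have hgn : grade ℕ g = n + 1 := by rw [grade_eq_of_covBy _ hfg, f.2]
      have h := downMap_single (YoungFibonacciPower (r + 1)) ℤ n ⟨g, hgn⟩
      rw [← Finset.add_sum_erase _ _ (Finset.mem_filter.2 ⟨Finset.mem_univ f, hfg⟩)] at h
      rw [eq_sub_of_add_eq h.symm]
      refine sub_mem ⟨_, rfl⟩ (sum_mem fun x hx => ?_)
      obtain ⟨hne, hx⟩ := Finset.mem_erase.1 hx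
      obtain ⟨i, hi, hi'⟩ := (covBy_iff_exists_step _).1 (Finset.mem_filter.1 hx).2
      have hi₀ : i ≠ 0 := by
        rintro rfl
        simp only [hg₀, step_one_right_iff] at hi
        refine hne (Subtype.ext (funext fun j => ?_))
        by_cases hj : j = 0
        · rw [hj, hi]
        · rw [hi' j hj]
          exact hg j hj
      have hx₀ : (x.1 0).letterSum = (f.1 0).letterSum + 1 := by
        rw [hi' 0 hi₀.symm]
        simp only [hg₀, letterSum]
      have hle : (x.1 0).letterSum ≤ n := by
        refine le_of_le_of_eq ?_ x.2
        exact Finset.single_le_sum (f := fun j => (x.1 j).letterSum) (fun _ _ => Nat.zero_le _)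
          (Finset.mem_univ 0)
      exact ih (k - 1) (by omega) x (by omega)
  rw [eq_top_iff]
  intro x _
  induction x using Finsupp.induction_linear with
  | zero => exact zero_mem _
  | add x y hx hy => exact add_mem (hx trivial) (hy trivial)
  | single f k =>
    have := Submodule.smul_mem _ k (key n f (by omega))
    rwa [Finsupp.smul_single, smul_eq_mul, mul_one] at this

end YoungFibonacciPower

namespace YoungFibonacciPower

open YoungFibonacci

/-! ### The numbers of elements of given rank -/

/-- The number of elements of rank `n` of `Z(r)`. -/
noncomputable def rankCard (r n : ℕ) : ℕ := Fintype.card (RankLevel (YoungFibonacciPower r) n)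

theorem rankCard_zero_succ (n : ℕ) : rankCard 0 (n + 1) = 0 := by
  refine Fintype.card_eq_zero_iff.2 ⟨fun f => ?_⟩
  have h := f.2
  rw [YoungFibonacciPower.grade_eq, Fin.sum_univ_zero] at h
  omega

theorem rankCard_zero_right (r : ℕ) : rankCard r 0 = 1 := by
  refine Fintype.card_eq_one_iff.2 ⟨⟨fun _ => nil, ?_⟩, fun f => Subtype.ext (funext fun i => ?_)⟩
  · rw [YoungFibonacciPower.grade_eq]
    exact Finset.sum_eq_zero fun _ _ => rfl
  · have h := f.2
    rw [YoungFibonacciPower.grade_eq, Finset.sum_eq_zero_iff] at h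
    have hi := h i (Finset.mem_univ i)
    revert hi
    show (f.1 i).letterSum = 0 → f.1 i = nil
    generalize f.1 i = w
    intro hi
    cases w with
    | nil => rfl
    | one u => exact absurd hi (Nat.succ_ne_zero _)
    | two u => exact absurd hi (Nat.succ_ne_zero _)

/-- Splitting off the first component of a tuple. -/
def rankLevelSuccEquiv (r n : ℕ) : RankLevel (YoungFibonacciPower (r + 1)) n ≃
    {x : YoungFibonacci × YoungFibonacciPower r // x.1.letterSum + grade ℕ x.2 = n} :=
  (Fin.consEquiv fun _ : Fin (r + 1) => YoungFibonacci).symm.subtypeEquiv fun f => by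
    rw [YoungFibonacciPower.grade_eq, YoungFibonacciPower.grade_eq, Fin.sum_univ_succ]
    rfl

theorem rankCard_eq (r n : ℕ) : rankCard (r + 1) n =
    Nat.card {x : YoungFibonacci × YoungFibonacciPower r // x.1.letterSum + grade ℕ x.2 = n} := by
  rw [rankCard, ← Nat.card_eq_fintype_card, Nat.card_congr (rankLevelSuccEquiv r n)]

theorem finite_pairs (r n : ℕ) :
    Finite {x : YoungFibonacci × YoungFibonacciPower r // x.1.letterSum + grade ℕ x.2 = n} :=
  Finite.of_equiv _ (rankLevelSuccEquiv r n)

theorem rankCard_succ_one (r : ℕ) :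
    rankCard (r + 1) 1 = rankCard (r + 1) 0 + rankCard r 1 := by
  have := finite_pairs r 0
  rw [rankCard_eq, rankCard_eq, rankCard, ← Nat.card_eq_fintype_card, ← Nat.card_sum]
  refine Nat.card_congr
    { toFun := fun
        | ⟨(nil, g), h⟩ => Sum.inr ⟨g, by simpa [letterSum] using h⟩
        | ⟨(one u, g), h⟩ => Sum.inl ⟨(u, g), by simp only [letterSum] at h ⊢; omega⟩
        | ⟨(two u, g), h⟩ => absurd h (by simp only [letterSum]; omega)
      invFun := fun
        | Sum.inr ⟨g, h⟩ => ⟨(nil, g), by simpa [letterSum] using h⟩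
        | Sum.inl ⟨(u, g), h⟩ => ⟨(one u, g), by simp only [letterSum] at h ⊢; omega⟩
      left_inv := ?_
      right_inv := ?_ }
  · rintro ⟨⟨_ | u | u, g⟩, h⟩
    · rfl
    · rfl
    · exact absurd h (by simp only [letterSum]; omega)
  · rintro (⟨⟨u, g⟩, h⟩ | ⟨g, h⟩) <;> rfl

/-- A tuple is determined by whether its first component is empty or starts with `1` or with `2`,
and by what is left of the tuple. -/
theorem rankCard_succ_add_two (r n : ℕ) : rankCard (r + 1) (n + 2) =
    rankCard (r + 1) (n + 1) + (rankCard (r + 1) n + rankCard r (n + 2)) := by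
  have := finite_pairs r n
  have := finite_pairs r (n + 1)
  rw [rankCard_eq, rankCard_eq, rankCard_eq, rankCard, ← Nat.card_eq_fintype_card,
    ← Nat.card_sum, ← Nat.card_sum]
  refine Nat.card_congr
    { toFun := fun
        | ⟨(nil, g), h⟩ => Sum.inr (Sum.inr ⟨g, by simpa [letterSum] using h⟩)
        | ⟨(one u, g), h⟩ => Sum.inl ⟨(u, g), by simp only [letterSum] at h ⊢; omega⟩
        | ⟨(two u, g), h⟩ => Sum.inr (Sum.inl ⟨(u, g), by simp only [letterSum] at h ⊢; omega⟩)
      invFun := fun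
        | Sum.inr (Sum.inr ⟨g, h⟩) => ⟨(nil, g), by simpa [letterSum] using h⟩
        | Sum.inl ⟨(u, g), h⟩ => ⟨(one u, g), by simp only [letterSum] at h ⊢; omega⟩
        | Sum.inr (Sum.inl ⟨(u, g), h⟩) => ⟨(two u, g), by simp only [letterSum] at h ⊢; omega⟩
      left_inv := ?_
      right_inv := ?_ }
  · rintro ⟨⟨_ | u | u, g⟩, h⟩ <;> rfl
  · rintro (⟨⟨u, g⟩, h⟩ | ⟨⟨u, g⟩, h⟩ | ⟨g, h⟩) <;> rfl

theorem rankCard_le_succ (r n : ℕ) : rankCard (r + 1) n ≤ rankCard (r + 1) (n + 1) := by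
  cases n with
  | zero => rw [rankCard_succ_one]; omega
  | succ n => rw [rankCard_succ_add_two]; omega

theorem rankCard_pos (r n : ℕ) : 0 < rankCard (r + 1) n := by
  induction n with
  | zero => rw [rankCard_zero_right]; exact one_pos
  | succ n ih => exact ih.trans_le (rankCard_le_succ r n)

/-- The rank sizes of `Z(r)` grow strictly for `r ≥ 2`. -/
theorem rankCard_lt_succ (r n : ℕ) : rankCard (r + 2) n < rankCard (r + 2) (n + 1) := by
  cases n with
  | zero =>
    have := rankCard_pos r 1
    have h : rankCard (r + 2) 1 = rankCard (r + 2) 0 + rankCard (r + 1) 1 :=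
      rankCard_succ_one (r + 1)
    rw [zero_add]
    omega
  | succ n =>
    have : 0 < rankCard (r + 2) n := rankCard_pos (r + 1) n
    have h : rankCard (r + 2) (n + 2) = rankCard (r + 2) (n + 1) +
      (rankCard (r + 2) n + rankCard (r + 1) (n + 2)) := rankCard_succ_add_two (r + 1) n
    rw [h]
    omega

/-! ### Smith generators in every rank -/

theorem hasSmithGenerators_zero (r : ℕ) : HasSmithGenerators (YoungFibonacciPower r) 0 1 :=
  .of_card_eq_one _ (rankCard_zero_right r)

theorem rankCard_one_one : rankCard 1 1 = 1 := by
  rw [rankCard_succ_one, rankCard_zero_right, rankCard_zero_succ]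

theorem rankCard_one_add_two (n : ℕ) : rankCard 1 (n + 2) = rankCard 1 (n + 1) + rankCard 1 n := by
  rw [rankCard_succ_add_two, rankCard_zero_succ, add_zero]

/-- In rank `1` of the Young–Fibonacci lattice, `UD` is the identity, since `D` is injective there and
`DU` is the identity in rank `0`. -/
theorem DUMap_one_one (x : RankLevel (YoungFibonacciPower 1) 1 →₀ ℤ) :
    DUMap ℤ (YoungFibonacciPower 1) 1 x = (2 : ℤ) • x := by
  have hcard : Fintype.card (RankLevel (YoungFibonacciPower 1) 1) =
      Fintype.card (RankLevel (YoungFibonacciPower 1) 0) :=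
    rankCard_one_one.trans (rankCard_zero_right 1).symm
  have hinj : Function.Injective (downMap ℤ (YoungFibonacciPower 1) 0) :=
    OrzechProperty.injective_of_surjective_of_injective
      (Finsupp.domLCongr (R := ℤ) (Fintype.equivOfCardEq hcard)).toLinearMap _
      (LinearEquiv.injective _) (downMap_surjective 1 0 le_rfl)
  have hUD : upMap ℤ _ 0 (downMap ℤ _ 0 x) = x := by
    apply hinj
    have := (upDownCommutation 1).zero ℤ (downMap ℤ _ 0 x)
    rwa [DUMap, LinearMap.comp_apply, Nat.cast_one, one_smul] at this
  rw [(upDownCommutation 1).succ, hUD]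
  module

theorem three_smul_mem_range_DUMap_one_two (x : RankLevel (YoungFibonacciPower 1) 2 →₀ ℤ) :
    (3 : ℤ) • x ∈ LinearMap.range (DUMap ℤ (YoungFibonacciPower 1) 2) := by
  -- Here `(UD)² = U(DU)D = 2UD`, hence `(UD + 1)(3 - UD) = 3`.
  have h := DUMap_one_one (downMap ℤ _ 1 x)
  rw [DUMap, LinearMap.comp_apply] at h
  refine ⟨(3 : ℤ) • x - upMap ℤ _ 1 (downMap ℤ _ 1 x), ?_⟩
  rw [(upDownCommutation 1).succ, map_sub, map_sub, h]
  simp only [map_smul]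
  module

theorem hasSmithGenerators_one_two : HasSmithGenerators (YoungFibonacciPower 1) 2 1 :=
  HasSmithGenerators.succ_of_one _ (upDownCommutation 1) (downMap_surjective 1 1 le_rfl)
    ((rankCard_one_add_two 0).trans (by rw [rankCard_zero_right]; rfl))
    (Or.inl fun x => ⟨x, DUMap_one_one x⟩) (.of_card_eq_one _ rankCard_one_one)

/-- For `r = 1`, the number of generators increases strictly from rank `3` on; the smaller ranks have
one generator each. -/
theorem hasSmithGenerators_one (n : ℕ) :
    HasSmithGenerators (YoungFibonacciPower 1) (n + 3) (rankCard 1 (n + 1)) := by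
  have hcomm := upDownCommutation 1
  have hD := fun n => downMap_surjective 1 n le_rfl
  induction n with
  | zero =>
    rw [zero_add, zero_add, rankCard_one_one]
    exact hasSmithGenerators_one_two.succ_of_one _ hcomm (hD 2)
      ((rankCard_one_add_two 1).trans (by rw [rankCard_one_one]; rfl))
      (Or.inr three_smul_mem_range_DUMap_one_two)
  | succ n ih =>
    refine ih.succ_of_lt _ hcomm (hD _) ?_ (rankCard_one_add_two (n + 2))
    have : 0 < rankCard 1 n := rankCard_pos 0 n
    rw [rankCard_one_add_two]
    omega

/-- In rank `1` there are `r + 1` generators, against one in rank `0`; for `r = 0` these numbers are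
equal, but `DU` is multiplication by `2` in rank `0`. -/
theorem hasSmithGenerators_add_two_one (r : ℕ) :
    HasSmithGenerators (YoungFibonacciPower (r + 2)) 1 (rankCard (r + 1) 1) := by
  have hcomm := upDownCommutation (r + 2)
  have hD := downMap_surjective (r + 2) 0 (by omega)
  have h := hasSmithGenerators_zero (r + 2)
  cases r with
  | zero =>
    have hm : rankCard 2 1 = rankCard 2 0 + 1 := by rw [rankCard_succ_one, rankCard_one_one]
    rw [zero_add, rankCard_one_one]
    exact h.succ_of_one _ hcomm hD hm (Or.inl fun x => ⟨x, hcomm.zero ℤ x⟩)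
  | succ r =>
    refine h.succ_of_lt _ hcomm hD ?_ (rankCard_succ_one _)
    have := rankCard_pos r 1
    rw [rankCard_succ_one, rankCard_zero_right]
    omega

/-- For at least two factors, the number of generators increases strictly from rank `1` on. -/
theorem hasSmithGenerators_add_two (r n : ℕ) : HasSmithGenerators (YoungFibonacciPower (r + 2))
    (n + 2) (rankCard (r + 2) n + rankCard (r + 1) (n + 2)) := by
  have hcomm := upDownCommutation (r + 2)
  have hD := fun n => downMap_surjective (r + 2) n (by omega)
  induction n with
  | zero =>
    refine (hasSmithGenerators_add_two_one r).succ_of_lt _ hcomm (hD 1) ?_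
      (rankCard_succ_add_two _ 0)
    have : rankCard (r + 1) 1 ≤ rankCard (r + 1) (0 + 2) := rankCard_le_succ r 1
    rw [rankCard_zero_right]
    omega
  | succ n ih =>
    refine ih.succ_of_lt _ hcomm (hD _) ?_ (rankCard_succ_add_two _ (n + 1))
    have h₁ : rankCard (r + 1) (n + 2) ≤ rankCard (r + 1) (n + 1 + 2) := rankCard_le_succ r (n + 2)
    have h₂ := rankCard_lt_succ r n
    omega

theorem exists_hasSmithGenerators (r n : ℕ) (hr : 1 ≤ r) :
    ∃ l, HasSmithGenerators (YoungFibonacciPower r) n l := by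
  match r, n, hr with
  | r, 0, _ => exact ⟨_, hasSmithGenerators_zero r⟩
  | 1, 1, _ => exact ⟨_, .of_card_eq_one _ rankCard_one_one⟩
  | 1, 2, _ => exact ⟨_, hasSmithGenerators_one_two⟩
  | 1, n + 3, _ => exact ⟨_, hasSmithGenerators_one n⟩
  | r + 2, 1, _ => exact ⟨_, hasSmithGenerators_add_two_one r⟩
  | r + 2, n + 2, _ => exact ⟨_, hasSmithGenerators_add_two r n⟩

end YoungFibonacciPower

theorem corollary5p3 (r : ℕ) (hr : 1 ≤ r) :
    MillerReinerConjectureFor (YoungFibonacciPower r) := by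
  intro n k e
  obtain ⟨l, h⟩ := YoungFibonacciPower.exists_hasSmithGenerators r n hr
  exact h.hasSmithNormalForm _ e
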